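/- Let $T, r \ge 0$ be integers and $I=\{0,1,\dots,T\}$. For a Polish space $U$ let $\mathcal S(U)$ be the collection of adapted processes $\mathbf X=(\Omega,\mathbb P,(\mathcal F_t)_{t\in I},X)$ with state space $U$: a filtered probability space (which may vary with $\mathbf X$) and maps $X_t:\Omega\to U$, $t\in I$, with $X_t$ $\mathcal F_t$-measurable. The *adapted functionals* are defined inductively: (i) $\mathbf X\mapsto g(X_{t_1},\dots,X_{t_n})$ with $t_i\in I$ and $g\in C_b(U^n,\mathbb R)$, of rank $0$; (ii) $\mathbf X\mapsto g(f_1(\mathbf X),\dots,f_n(\mathbf X))$ with adapted functionals $f_i$ and $g\in C_b(\mathbb R^n,\mathbb R)$, of rank $\max_i \operatorname{rank} f_i$; (iii) $\mathbf X\mapsto \mathbb E[f(\mathbf X)\mid\mathcal F_t]$ with an adapted functional $f$ and $t\in I$, of rank $\operatorname{rank} f+1$. The *adapted topology of rank $r$*, $\tau_r$, is the initial topology on $\mathcal S(U)$ of the maps $\mathbf X\mapsto\mathbb E[f(\mathbf X)]$, $f$ an adapted functional of rank at most $r$; thus $\mathbf X^n\to\mathbf X$ in $\tau_r$ if and only if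 $\mathbb E[f(\mathbf X^n)]\to\mathbb E[f(\mathbf X)]$ for all such $f$. Put $U_0=U$ and let $U_{k+1}$ be the space of Borel probability measures on $U_k^I$ with the topology of weak convergence. The *prediction processes* of $\mathbf X$ are $\hat X^0=X$ and $\hat X^{k+1}_t=\mathbb P(\hat X^k\in\cdot\mid\mathcal F_t)$ (regular conditional law of the whole path $\hat X^k=(\hat X^k_s)_{s\in I}$), $t\in I$, so that $\hat X^k$ has state space $U_k$. The *extended weak topology of rank $r$*, $\hat\tau_r$, is the initial topology on $\mathcal S(U)$ of the maps $\mathbf X\mapsto\mathbb E[f(\hat X^r)]$, $f\in C_b(U_r^I,\mathbb R)$; thus $\mathbf X^n\to\mathbf X$ in $\hat\tau_r$ if and only if the paths of their rank $r$ prediction processes converge in law. Let $V$ be a separable Banach space. Then $\tau_r\subset\hat\tau_r$ on $\mathcal S(V)$; in particular, every sequence that converges to $\mathbf X$ in $(\mathcal S(V),\hat\tau_r)$ converges to $\mathbf X$ in $(\mathcal S(V),\tau_r)$. Moreover, for every compact $K\subset V$, $\tau_r=\hat\tau_r$ on $\mathcal S(K)$; in particular, the two topologies have the same convergent sequences with the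 same limits. -/

import Mathlib

open MeasureTheory ProbabilityTheory Filter Topology TopologicalSpace
open scoped BoundedContinuousFunction

universe u v

/-! ### Spaces of probability measures

For a separable metrizable Borel space `X`, the space `ProbabilityMeasure X` with the topology of
weak convergence is again separable metrizable, its Borel σ-algebra is the one generated by the
evaluations `μ ↦ μ s`, and it is standard Borel if `X` is. -/

section ProbabilityMeasureSpaces

theorem mem_nhds_generateFrom {α : Type*} {g : Set (Set α)} {s : Set α} (hs : s ∈ g) {a : α}
    (ha : a ∈ s) : s ∈ @nhds α (generateFrom g) a := by
  let := generateFrom g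
  exact (isOpen_generateFrom_of_mem hs).mem_nhds ha

variable {X : Type*} [TopologicalSpace X] [MeasurableSpace X]

theorem isInducing_probabilityMeasure_map {K : Type*} [TopologicalSpace K] [MeasurableSpace K]
    [SecondCountableTopology X] [MetrizableSpace X] [BorelSpace X]
    [SecondCountableTopology K] [MetrizableSpace K] [BorelSpace K]
    {e : X → K} (he : IsInducing e) :
    IsInducing (fun μ : ProbabilityMeasure X =>
      μ.map he.continuous.measurable.aemeasurable) := by
  rw [isInducing_iff_nhds]
  intro μ
  refine le_antisymm ?_ ?_
  · rw [← tendsto_iff_comap]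
    exact (ProbabilityMeasure.continuous_map he.continuous).continuousAt
  · refine tendsto_id'.1 ?_
    refine tendsto_of_forall_isOpen_le_liminf' (μs := id) fun G hG => ?_
    obtain ⟨W, hW, rfl⟩ := he.isOpen_iff.1 hG
    have h := ProbabilityMeasure.le_liminf_measure_open_of_tendsto
      (tendsto_comap : Tendsto (fun μ : ProbabilityMeasure X =>
        μ.map he.continuous.measurable.aemeasurable) (comap _
          (𝓝 (μ.map he.continuous.measurable.aemeasurable))) _) hW
    simpa [ProbabilityMeasure.toMeasure_map,
      Measure.map_apply he.continuous.measurable hW.measurableSet] using h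

instance instSecondCountableProbabilityMeasure [SecondCountableTopology X] [MetrizableSpace X]
    [BorelSpace X] : SecondCountableTopology (ProbabilityMeasure X) := by
  let := metrizableSpaceMetric X
  obtain ⟨e, he⟩ := Metric.PiNatEmbed.exists_embedding_to_hilbert_cube (X := X)
  let := metrizableSpaceMetric (ProbabilityMeasure (ℕ → unitInterval))
  exact (isInducing_probabilityMeasure_map he.isInducing).secondCountableTopology

theorem measurable_probabilityMeasure_apply_of_isOpen [SecondCountableTopology X]
    [MetrizableSpace X] [BorelSpace X] {G : Set X} (hG : IsOpen G) :
    Measurable[borel (ProbabilityMeasure X)]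
      (fun μ : ProbabilityMeasure X => (μ : Measure X) G) := by
  let : MeasurableSpace (ProbabilityMeasure X) := borel _
  have : BorelSpace (ProbabilityMeasure X) := ⟨rfl⟩
  refine LowerSemicontinuous.measurable ?_
  rw [lowerSemicontinuous_iff_le_liminf]
  intro μ
  exact ProbabilityMeasure.le_liminf_measure_open_of_tendsto tendsto_id hG

instance instBorelSpaceProbabilityMeasure [SecondCountableTopology X] [MetrizableSpace X]
    [BorelSpace X] : BorelSpace (ProbabilityMeasure X) := by
  refine ⟨le_antisymm ?_ ?_⟩
  · have h : Measurable[borel (ProbabilityMeasure X)]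
        (fun μ : ProbabilityMeasure X => (μ : Measure X)) := by
      refine @Measurable.measure_of_isPiSystem_of_isProbabilityMeasure _ _ (borel _) _ _ _
        {s : Set X | IsOpen s} (BorelSpace.measurable_eq) isPiSystem_isOpen ?_
      intro s hs
      exact measurable_probabilityMeasure_apply_of_isOpen hs
    exact measurable_iff_comap_le.1 h
  · have hsub : (inferInstance : TopologicalSpace (ProbabilityMeasure X)) =
        generateFrom {S | ∃ f : X →ᵇ ℝ, ∃ V : Set ℝ, IsOpen V ∧
          S = (fun μ : ProbabilityMeasure X => ∫ x, f x ∂(μ : Measure X)) ⁻¹' V} := by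
      refine le_antisymm (le_generateFrom ?_) ?_
      · rintro S ⟨f, V, hV, rfl⟩
        exact hV.preimage (ProbabilityMeasure.continuous_integral_boundedContinuousFunction f)
      · refine le_of_nhds_le_nhds fun μ => tendsto_id'.1 ?_
        refine ProbabilityMeasure.tendsto_iff_forall_integral_tendsto.2 fun f => ?_
        refine tendsto_nhds.2 fun V hV hμ => ?_
        exact mem_nhds_generateFrom (by exact ⟨f, V, hV, rfl⟩) hμ
    rw [borel_eq_generateFrom_of_subbasis hsub]
    refine MeasurableSpace.generateFrom_le ?_
    rintro S ⟨f, V, hV, rfl⟩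
    have hm : Measurable (fun μ : ProbabilityMeasure X => ∫ x, f x ∂(μ : Measure X)) := by
      let κ : Kernel (ProbabilityMeasure X) X := ⟨fun μ => (μ : Measure X), measurable_subtype_coe⟩
      have : IsMarkovKernel κ := ⟨fun μ => inferInstanceAs (IsProbabilityMeasure (μ : Measure X))⟩
      exact (StronglyMeasurable.integral_kernel (κ := κ)
        f.continuous.stronglyMeasurable).measurable
    exact hm hV.measurableSet

theorem standardBorelSpace_of_measurableEquiv {α β : Type*} [MeasurableSpace α]
    [MeasurableSpace β] [StandardBorelSpace β] (φ : α ≃ᵐ β) : StandardBorelSpace α := by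
  let := upgradeStandardBorel β
  let t : TopologicalSpace α := TopologicalSpace.induced φ inferInstance
  refine ⟨t, ⟨?_⟩, φ.toEquiv.polishSpace_induced⟩
  rw [borel_comap, ← BorelSpace.measurable_eq (α := β)]
  refine le_antisymm ?_ φ.measurable.comap_le
  intro s hs
  refine ⟨φ.symm ⁻¹' s, φ.symm.measurable hs, ?_⟩
  ext x
  simp

instance instStandardBorelProbabilityMeasure {X : Type*} [MeasurableSpace X]
    [StandardBorelSpace X] : StandardBorelSpace (ProbabilityMeasure X) := by
  obtain ⟨e₀, he₀⟩ := exists_measurableEmbedding_real X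
  let e : X → EReal := fun x => (e₀ x : EReal)
  have he : MeasurableEmbedding e := EReal.measurableEmbedding_coe.comp he₀
  let : MetricSpace (ProbabilityMeasure EReal) := metrizableSpaceMetric _
  let R : Set (ProbabilityMeasure EReal) := {ν | (ν : Measure EReal) (Set.range e) = 1}
  have hR : MeasurableSet R :=
    ((Measure.measurable_coe he.measurableSet_range).comp measurable_subtype_coe)
      (measurableSet_singleton 1)
  have := hR.standardBorel
  refine standardBorelSpace_of_measurableEquiv (β := R) ?_
  refine
    { toFun := fun μ => ⟨μ.map he.measurable.aemeasurable, ?_⟩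
      invFun := fun ν => ⟨(ν.1 : Measure EReal).comap e, ⟨?_⟩⟩
      left_inv := ?_
      right_inv := ?_
      measurable_toFun := ?_
      measurable_invFun := ?_ }
  · simp only [R, Set.mem_ofPred_eq, ProbabilityMeasure.toMeasure_map]
    rw [Measure.map_apply he.measurable he.measurableSet_range]
    simp
  · rw [he.comap_apply, Set.image_univ]
    exact ν.2
  · intro μ
    exact Subtype.ext (he.comap_map _)
  · intro ν
    refine Subtype.ext (Subtype.ext ?_)
    refine (he.map_comap _).trans ?_
    refine Measure.restrict_eq_self_of_ae_mem ?_
    have h1 : (ν.1 : Measure EReal) (Set.range e) = 1 := ν.2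
    exact (prob_compl_eq_zero_iff he.measurableSet_range).2 h1
  · exact (((Measure.measurable_map e he.measurable).comp
      measurable_subtype_coe).subtype_mk).subtype_mk
  · refine Measurable.subtype_mk ?_
    refine Measure.measurable_of_measurable_coe _ fun s hs => ?_
    simp only [he.comap_apply]
    exact (Measure.measurable_coe (he.measurableSet_image' hs)).comp
      (measurable_subtype_coe.comp measurable_subtype_coe)

end ProbabilityMeasureSpaces

noncomputable section

/-! ### Adapted processes -/

/-- An adapted stochastic process in discrete time `{0, 1, …, T}` with state space `U`: a filtered
probability space together with a process on it whose value at time `t` is `ℱ t`-measurable.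
Different processes may live on different filtered probability spaces. -/
structure AdaptedProcess (T : ℕ) (U : Type v) [MeasurableSpace U] : Type (max (u + 1) v) where
  /-- the sample space -/
  Ω : Type u
  /-- the σ-algebra of the sample space -/
  [mΩ : MeasurableSpace Ω]
  /-- the probability measure -/
  P : Measure Ω
  [isProbabilityMeasure : IsProbabilityMeasure P]
  /-- the filtration -/
  ℱ : Filtration (Fin (T + 1)) mΩ
  /-- the process -/
  X : Fin (T + 1) → Ω → U
  adapted : Adapted ℱ X

attribute [instance] AdaptedProcess.mΩ AdaptedProcess.isProbabilityMeasure

namespace AdaptedProcess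

variable {T : ℕ} {U : Type v}

/-- The path of the process at the sample point `ω`. -/
def path [MeasurableSpace U] (A : AdaptedProcess.{u, v} T U) (ω : A.Ω) : Fin (T + 1) → U :=
  fun t => A.X t ω

theorem nonempty_path [MeasurableSpace U] (A : AdaptedProcess.{u, v} T U) :
    Nonempty (Fin (T + 1) → U) :=
  A.P.nonempty_of_neZero.map A.path

/-- A regular version of `ℙ(X ∈ · | ℱ_t)`, the conditional law of the whole path given the
information at time `t`: the regular conditional distribution of the path given the identity map
from the sample space to the sample space equipped with the σ-algebra `ℱ_t`. -/
def condLaw [MeasurableSpace U] [StandardBorelSpace U] (A : AdaptedProcess.{u, v} T U)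
    (t : Fin (T + 1)) : @Kernel A.Ω (Fin (T + 1) → U) (A.ℱ t) _ :=
  have := A.nonempty_path
  @condDistrib A.Ω A.Ω (Fin (T + 1) → U) _ _ _ A.mΩ (A.ℱ t) A.path id A.P _

instance [MeasurableSpace U] [StandardBorelSpace U] (A : AdaptedProcess.{u, v} T U)
    (t : Fin (T + 1)) (ω : A.Ω) : IsProbabilityMeasure (A.condLaw t ω) := by
  have := A.nonempty_path
  unfold condLaw
  infer_instance

/-- The prediction process `t ↦ ℙ(X ∈ · | ℱ_t)` of an adapted process, an adapted process on the
same filtered probability space whose states are laws on path space. -/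
def prediction [MeasurableSpace U] [StandardBorelSpace U] (A : AdaptedProcess.{u, v} T U) :
    AdaptedProcess.{u, v} T (ProbabilityMeasure (Fin (T + 1) → U)) where
  Ω := A.Ω
  P := A.P
  ℱ := A.ℱ
  X t ω := ⟨A.condLaw t ω, inferInstance⟩
  adapted t := (A.condLaw t).measurable.subtype_mk

/-- The values of the prediction process are conditional probabilities of the path. -/
theorem prediction_ae_eq_condExp [MeasurableSpace U] [StandardBorelSpace U]
    (A : AdaptedProcess.{u, v} T U) (t : Fin (T + 1)) {B : Set (Fin (T + 1) → U)}
    (hB : MeasurableSet B) :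
    (fun ω => (A.prediction.X t ω : Measure (Fin (T + 1) → U)).real B) =ᵐ[A.P]
      A.P⟦A.path ⁻¹' B | A.ℱ t⟧ := by
  have := A.nonempty_path
  have hpath : Measurable A.path := measurable_pi_lambda _ fun s => A.adapted.measurable
  have h := @condDistrib_ae_eq_condExp A.Ω A.Ω (Fin (T + 1) → U) _ _ _ A.mΩ A.P _ id A.path
    (A.ℱ t) B (measurable_id'' (A.ℱ.le t)) hpath hB
  rwa [MeasurableSpace.comap_id] at h

end AdaptedProcess

/-! ### Prediction processes of higher rank -/

/-- A separable metrizable space with its Borel σ-algebra, which is moreover standard Borel. -/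
structure StateSpace : Type (v + 1) where
  carrier : Type v
  [top : TopologicalSpace carrier]
  [meas : MeasurableSpace carrier]
  [secondCountable : SecondCountableTopology carrier]
  [metrizable : MetrizableSpace carrier]
  [borel : BorelSpace carrier]
  [standardBorel : StandardBorelSpace carrier]

instance : CoeSort StateSpace.{v} (Type v) := ⟨StateSpace.carrier⟩

attribute [instance] StateSpace.top StateSpace.meas StateSpace.secondCountable
  StateSpace.metrizable StateSpace.borel StateSpace.standardBorel

/-- The state space of the prediction process of rank `r`, that is, the space of rank `r`
probability measures on `U`: it is `U` for `r = 0`, and for `r + 1` it is the space of probability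
measures on paths `{0, …, T} → rankSpace T U r`, with the topology of weak convergence. -/
def rankSpace (T : ℕ) (U : Type v) [TopologicalSpace U] [PolishSpace U] [MeasurableSpace U]
    [BorelSpace U] : ℕ → StateSpace.{v}
  | 0 => ⟨U⟩
  | r + 1 => ⟨ProbabilityMeasure (Fin (T + 1) → rankSpace T U r)⟩

variable {T : ℕ} {U : Type v} [TopologicalSpace U] [PolishSpace U] [MeasurableSpace U]
  [BorelSpace U]

/-- The prediction process of rank `r`: the process itself for `r = 0`, and the prediction process
of the rank `r` prediction process for `r + 1`. -/
def AdaptedProcess.predictionOfRank (A : AdaptedProcess.{u, v} T U) :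
    (r : ℕ) → AdaptedProcess.{u, v} T (rankSpace T U r)
  | 0 => A
  | r + 1 => (A.predictionOfRank r).prediction

/-! ### Adapted functionals -/

/-- Adapted functionals, built in three ways: from bounded continuous functions of finitely many
values of the process, by composing finitely many adapted functionals with a bounded continuous
function, and by taking the conditional expectation at some time `t`. -/
inductive AdaptedFunctional (T : ℕ) (U : Type v) [TopologicalSpace U] : Type v
  | base (n : ℕ) (t : Fin n → Fin (T + 1)) (g : (Fin n → U) →ᵇ ℝ) : AdaptedFunctional T U
  | comp (n : ℕ) (f : Fin n → AdaptedFunctional T U) (g : (Fin n → ℝ) →ᵇ ℝ) :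
      AdaptedFunctional T U
  | condExp (f : AdaptedFunctional T U) (t : Fin (T + 1)) : AdaptedFunctional T U

namespace AdaptedFunctional

/-- The random variable `f(A)`, defined up to almost sure equality. -/
def eval {T : ℕ} {U : Type v} [TopologicalSpace U] [MeasurableSpace U]
    (A : AdaptedProcess.{u, v} T U) : AdaptedFunctional T U → A.Ω → ℝ
  | base _ t g => fun ω => g fun i => A.X (t i) ω
  | comp _ f g => fun ω => g fun i => (f i).eval A ω
  | condExp f t => A.P[f.eval A | A.ℱ t]

/-- The rank of an adapted functional: the number of nested conditional expectations. -/
def rank {T : ℕ} {U : Type v} [TopologicalSpace U] : AdaptedFunctional T U → ℕ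
  | base _ _ _ => 0
  | comp _ f _ => Finset.univ.sup fun i => (f i).rank
  | condExp f _ => f.rank + 1

end AdaptedFunctional

/-! ### The two topologies of rank `r` -/

/-- The expectation `𝔼[f(A)]` of an adapted functional. -/
def adaptedExpectation {T : ℕ} {U : Type v} [TopologicalSpace U] [MeasurableSpace U]
    (f : AdaptedFunctional T U) (A : AdaptedProcess.{u, v} T U) : ℝ :=
  ∫ ω, f.eval A ω ∂A.P

/-- The expectation of a bounded continuous function of the path of the rank `r` prediction
process. -/
def predictionExpectation (r : ℕ) (f : (Fin (T + 1) → rankSpace T U r) →ᵇ ℝ)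
    (A : AdaptedProcess.{u, v} T U) : ℝ :=
  ∫ ω, f ((A.predictionOfRank r).path ω) ∂(A.predictionOfRank r).P

/-- Convergence of a sequence of processes in the adapted topology of rank `r`. -/
def ConvergesAdapted (r : ℕ) (A : ℕ → AdaptedProcess.{u, v} T U) (B : AdaptedProcess.{u, v} T U) :
    Prop :=
  ∀ f : AdaptedFunctional T U, f.rank ≤ r →
    Tendsto (fun n => adaptedExpectation f (A n)) atTop (𝓝 (adaptedExpectation f B))

/-- Convergence of a sequence of processes in the extended weak topology of rank `r`: the rank `r`
prediction processes converge in law, as random paths. -/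
def ConvergesExtendedWeak (r : ℕ) (A : ℕ → AdaptedProcess.{u, v} T U)
    (B : AdaptedProcess.{u, v} T U) : Prop :=
  ∀ f : (Fin (T + 1) → rankSpace T U r) →ᵇ ℝ,
    Tendsto (fun n => predictionExpectation r f (A n)) atTop (𝓝 (predictionExpectation r f B))

variable (T U) in
/-- The adapted topology of rank `r` on the adapted processes: the initial topology of the maps
`A ↦ 𝔼[f(A)]`, where `f` ranges over the adapted functionals of rank at most `r`. -/
abbrev adaptedTopology (r : ℕ) : TopologicalSpace (AdaptedProcess.{u, v} T U) :=
  ⨅ f : {f : AdaptedFunctional T U // f.rank ≤ r},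
    TopologicalSpace.induced (adaptedExpectation f.1) inferInstance

variable (T U) in
/-- The extended weak topology of rank `r` on the adapted processes: the initial topology of the
maps which send a process to the expectation of a bounded continuous function of its rank `r`
prediction process. -/
abbrev extendedWeakTopology (r : ℕ) : TopologicalSpace (AdaptedProcess.{u, v} T U) :=
  ⨅ f : (Fin (T + 1) → rankSpace T U r) →ᵇ ℝ,
    TopologicalSpace.induced (predictionExpectation r f) inferInstance

theorem tendsto_adaptedTopology_iff {T : ℕ} {W : Type v} [TopologicalSpace W] [MeasurableSpace W]
    {r : ℕ} {A : ℕ → AdaptedProcess.{u, v} T W} {B : AdaptedProcess.{u, v} T W} :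
    Tendsto A atTop (@nhds _ (adaptedTopology T W r) B) ↔ ConvergesAdapted r A B := by
  unfold adaptedTopology
  rw [nhds_iInf]
  simp only [nhds_induced, tendsto_iInf, tendsto_comap_iff, ConvergesAdapted, Subtype.forall]
  rfl

theorem tendsto_extendedWeakTopology_iff {r : ℕ} {A : ℕ → AdaptedProcess.{u, v} T U}
    {B : AdaptedProcess.{u, v} T U} :
    Tendsto A atTop (@nhds _ (extendedWeakTopology T U r) B) ↔ ConvergesExtendedWeak r A B := by
  unfold extendedWeakTopology
  rw [nhds_iInf]
  simp only [nhds_induced, tendsto_iInf, tendsto_comap_iff, ConvergesExtendedWeak]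
  rfl

end

noncomputable section

/-! Both inclusions rest on one relation: an adapted functional `f` is represented by a function `F`
on rank `k` paths if `f` equals `F` of the rank `k` prediction path almost surely, with the same `F`
for every process. Expectations of `f` and of `F` then agree on all processes.

Every adapted functional of rank at most `k` has a bounded continuous representative
(`exists_isRepresentedBy`). Conditioning at `t` replaces `F` by `μ ↦ ∫ F dμ_t`, which raises the
rank by one. To bring functionals of different ranks to a common level, the rank `k` path is read
off the rank `k + 1` path: the time `t` marginal of the time `t` conditional law is almost surely
the Dirac mass at the current value. This gives the first inclusion.

If the state space is compact, so are all path spaces of higher rank. By induction on the rank,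
Stone–Weierstrass shows that the represented continuous functions are uniformly dense
(`representedSubalgebra_dense`). A uniform error on paths is a uniform error of expectations over
all processes, so each map defining the extended weak topology is a uniform limit of maps continuous
for the adapted topology. -/

theorem ae_condDistrib_map_eq_dirac {Ω β E E' : Type*} {mΩ : MeasurableSpace Ω}
    {mβ : MeasurableSpace β} [MeasurableSpace E] [StandardBorelSpace E] [Nonempty E]
    [MeasurableSpace E'] [StandardBorelSpace E'] [Nonempty E'] {μ : Measure Ω} [IsFiniteMeasure μ]
    {X : Ω → β} {Y : Ω → E} (hX : Measurable X) (hY : Measurable Y) {f : E → E'} {g : β → E'}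
    (hf : Measurable f) (hg : Measurable g) (hfg : f ∘ Y = g ∘ X) :
    ∀ᵐ ω ∂μ, (condDistrib Y X μ (X ω)).map f = Measure.dirac (g (X ω)) := by
  have h1 := condDistrib_comp (μ := μ) (mβ := mβ) X hY.aemeasurable hf
  rw [hfg] at h1
  filter_upwards [ae_of_ae_map hX.aemeasurable
    (h1.symm.trans (condDistrib_comp_self (μ := μ) X hg))] with ω hω
  rwa [Kernel.map_apply _ hf, Kernel.deterministic_apply] at hω

/-! ### Prediction processes and conditional laws. -/

namespace AdaptedProcess

section Prediction

variable {T : ℕ} {U : Type v} [MeasurableSpace U]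

theorem measurable_path (A : AdaptedProcess.{u, v} T U) : Measurable A.path :=
  measurable_pi_lambda _ fun s => (A.adapted s).mono (A.ℱ.le s) le_rfl

variable [StandardBorelSpace U]

/-- Integrals against the values of the prediction process are conditional expectations. -/
theorem condExp_comp_path_ae_eq (A : AdaptedProcess.{u, v} T U) (t : Fin (T + 1))
    {F : (Fin (T + 1) → U) → ℝ} (hF : StronglyMeasurable F) {C : ℝ} (hC : ∀ x, ‖F x‖ ≤ C) :
    A.P[fun ω => F (A.path ω) | A.ℱ t] =ᵐ[A.P]
      fun ω => ∫ x, F x ∂(A.prediction.X t ω : Measure (Fin (T + 1) → U)) := by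
  have := A.nonempty_path
  have hint : Integrable (fun ω => F (A.path ω)) A.P :=
    Integrable.of_bound (hF.comp_measurable A.measurable_path).aestronglyMeasurable C
      (Eventually.of_forall fun ω => hC _)
  have h := @condExp_ae_eq_integral_condDistrib A.Ω A.Ω (Fin (T + 1) → U) ℝ _ _ _ _ A.mΩ A.P _
    id A.path (A.ℱ t) _ _ (measurable_id'' (A.ℱ.le t)) A.measurable_path.aemeasurable F hF hint
  rwa [MeasurableSpace.comap_id] at h

/-- At time `t` the value of the process at time `t` is known. -/
theorem prediction_map_eval_ae_eq_dirac (A : AdaptedProcess.{u, v} T U) (t : Fin (T + 1)) :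
    ∀ᵐ ω ∂A.P, (A.prediction.X t ω : Measure (Fin (T + 1) → U)).map (fun x => x t) =
      Measure.dirac (A.X t ω) := by
  have := A.nonempty_path
  have hU : Nonempty U := this.map fun x => x t
  have hm : Measurable[A.mΩ, A.ℱ t] (id : A.Ω → A.Ω) := measurable_id'' (A.ℱ.le t)
  exact @ae_condDistrib_map_eq_dirac A.Ω A.Ω (Fin (T + 1) → U) U A.mΩ (A.ℱ t) _ _ _ _ _ _ A.P _
    id A.path hm A.measurable_path (fun x => x t) (A.X t) (measurable_pi_apply t) (A.adapted t) rfl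

end Prediction

variable {T : ℕ} {U : Type v} [TopologicalSpace U] [PolishSpace U] [MeasurableSpace U]
  [BorelSpace U]

/-- The rank `k` prediction process as a process on the sample space of `A`. -/
def rankPrediction (A : AdaptedProcess.{u, v} T U) :
    (k : ℕ) → {X : Fin (T + 1) → A.Ω → rankSpace T U k // Adapted A.ℱ X}
  | 0 => ⟨A.X, A.adapted⟩
  | k + 1 =>
    let B : AdaptedProcess.{u, v} T (rankSpace T U k) :=
      { Ω := A.Ω, P := A.P, ℱ := A.ℱ, X := (A.rankPrediction k).1, adapted := (A.rankPrediction k).2 }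
    ⟨B.prediction.X, B.prediction.adapted⟩

/-- The filtered probability space of `A` with the rank `k` prediction process. -/
abbrev withRank (A : AdaptedProcess.{u, v} T U) (k : ℕ) :
    AdaptedProcess.{u, v} T (rankSpace T U k) :=
  { Ω := A.Ω, P := A.P, ℱ := A.ℱ, X := (A.rankPrediction k).1, adapted := (A.rankPrediction k).2 }

/-- For variable `k` the sample space of `A.predictionOfRank k` does not reduce to `A.Ω`; that of
`A.withRank k` does, so almost sure statements about different ranks can be combined on `A.Ω`. -/
theorem predictionOfRank_eq_withRank (A : AdaptedProcess.{u, v} T U) (k : ℕ) :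
    A.predictionOfRank k = A.withRank k := by
  induction k with
  | zero => rfl
  | succ k ih =>
    change (A.predictionOfRank k).prediction = _
    rw [ih]
    rfl

/-- The path of the rank `k` prediction process at a sample point of `A`. -/
def rankPath (A : AdaptedProcess.{u, v} T U) (k : ℕ) (ω : A.Ω) :
    Fin (T + 1) → rankSpace T U k :=
  (A.withRank k).path ω

theorem measurable_rankPath (A : AdaptedProcess.{u, v} T U) (k : ℕ) : Measurable (A.rankPath k) :=
  (A.withRank k).measurable_path

theorem predictionExpectation_eq (A : AdaptedProcess.{u, v} T U) (k : ℕ)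
    (F : (Fin (T + 1) → rankSpace T U k) →ᵇ ℝ) :
    predictionExpectation k F A = ∫ ω, F (A.rankPath k ω) ∂A.P := by
  unfold predictionExpectation
  rw [predictionOfRank_eq_withRank]
  rfl

end AdaptedProcess

/-! ### Continuous functions on spaces of laws. -/

section Integrals

variable {ι : Type*} [Fintype ι] {E : Type*} [TopologicalSpace E] [MeasurableSpace E]

/-- The bounded continuous function `μ ↦ ∫ F dμ` on the space of probability measures. -/
def integralBCF [OpensMeasurableSpace E] (F : E →ᵇ ℝ) : ProbabilityMeasure E →ᵇ ℝ :=
  BoundedContinuousFunction.ofNormedAddCommGroup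
    (fun μ => ∫ x, F x ∂(μ : Measure E))
    (ProbabilityMeasure.continuous_integral_boundedContinuousFunction F) ‖F‖ fun μ =>
      F.norm_integral_le_norm (μ : Measure E)

variable [SecondCountableTopology E] [MetrizableSpace E] [BorelSpace E]

theorem continuous_pi_map_eval :
    Continuous fun μ : ι → ProbabilityMeasure (ι → E) =>
      ProbabilityMeasure.pi fun i => (μ i).map (measurable_pi_apply i).aemeasurable := by
  refine ProbabilityMeasure.continuous_pi.comp (continuous_pi fun i => ?_)
  exact (ProbabilityMeasure.continuous_map (continuous_apply i)).comp (continuous_apply i)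

/-- The integral of `F` against the product of the diagonal marginals of a family of laws on path
space. -/
def diagonalBCF (F : (ι → E) →ᵇ ℝ) : (ι → ProbabilityMeasure (ι → E)) →ᵇ ℝ :=
  (integralBCF F).compContinuous ⟨_, continuous_pi_map_eval⟩

/-- A product of Dirac masses is the Dirac mass at the point with these coordinates. Taking the
product of marginals makes the recovery of `F x` continuous on all families of laws, also where the
marginals are not Dirac. -/
theorem diagonalBCF_eq_of_map_eval_eq_dirac (F : (ι → E) →ᵇ ℝ)
    {μ : ι → ProbabilityMeasure (ι → E)} {x : ι → E}
    (h : ∀ i, (μ i : Measure (ι → E)).map (fun y => y i) = Measure.dirac (x i)) :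
    diagonalBCF F μ = F x := by
  change ∫ y, F y ∂(Measure.pi fun i => (μ i : Measure (ι → E)).map (fun y => y i)) = F x
  simp_rw [h]
  rw [← Measure.infinitePi_eq_pi, Measure.infinitePi_dirac, integral_dirac]

end Integrals

/-! ### Adapted functionals as functions of prediction paths. -/

namespace AdaptedFunctional

variable {T : ℕ} {U : Type v} [TopologicalSpace U] [PolishSpace U] [MeasurableSpace U]
  [BorelSpace U]

/-- The adapted functional `f` is almost surely the function `F` of the path of the rank `k`
prediction process. -/
def IsRepresentedBy (f : AdaptedFunctional T U) {k : ℕ}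
    (F : (Fin (T + 1) → rankSpace T U k) → ℝ) : Prop :=
  ∀ A : AdaptedProcess.{u, v} T U, f.eval A =ᵐ[A.P] fun ω => F (A.rankPath k ω)

theorem IsRepresentedBy.adaptedExpectation_eq {f : AdaptedFunctional T U} {k : ℕ}
    {F : (Fin (T + 1) → rankSpace T U k) →ᵇ ℝ} (h : IsRepresentedBy.{u} f F)
    (A : AdaptedProcess.{u, v} T U) :
    adaptedExpectation f A = predictionExpectation k F A := by
  rw [A.predictionExpectation_eq]
  exact integral_congr_ae (h A)

theorem IsRepresentedBy.condExp {f : AdaptedFunctional T U} {k : ℕ}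
    {F : (Fin (T + 1) → rankSpace T U k) →ᵇ ℝ} (h : IsRepresentedBy.{u} f F) (t : Fin (T + 1)) :
    IsRepresentedBy.{u} (f.condExp t) (k := k + 1) fun μ => integralBCF F (μ t) := fun A =>
  (condExp_congr_ae (h A)).trans <|
    (A.withRank k).condExp_comp_path_ae_eq t F.continuous.stronglyMeasurable F.norm_coe_le_norm

theorem IsRepresentedBy.comp {n : ℕ} {f : Fin n → AdaptedFunctional T U} {k : ℕ}
    {F : Fin n → (Fin (T + 1) → rankSpace T U k) → ℝ}
    (h : ∀ i, IsRepresentedBy.{u} (f i) (F i)) (g : (Fin n → ℝ) →ᵇ ℝ) :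
    IsRepresentedBy.{u} (comp n f g) fun x => g fun i => F i x := fun A => by
  filter_upwards [ae_all_iff.2 fun i => h i A] with ω hω
  change g (fun i => (f i).eval A ω) = _
  simp only [hω]

/-- The diagonal marginals of the rank `k + 1` path are almost surely Dirac masses at the values of
the rank `k` path, so no information is lost in passing to higher rank. -/
theorem IsRepresentedBy.succ {f : AdaptedFunctional T U} {k : ℕ}
    {F : (Fin (T + 1) → rankSpace T U k) →ᵇ ℝ} (h : IsRepresentedBy.{u} f F) :
    IsRepresentedBy.{u} f (k := k + 1) (diagonalBCF F) := fun A => by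
  filter_upwards [h A, ae_all_iff.2 fun t => (A.withRank k).prediction_map_eval_ae_eq_dirac t]
    with ω hω hd
  rw [hω]
  exact (diagonalBCF_eq_of_map_eval_eq_dirac F hd).symm

theorem exists_isRepresentedBy_of_le {f : AdaptedFunctional T U} {j k : ℕ} (hjk : j ≤ k)
    {F : (Fin (T + 1) → rankSpace T U j) →ᵇ ℝ} (h : IsRepresentedBy.{u} f F) :
    ∃ G : (Fin (T + 1) → rankSpace T U k) →ᵇ ℝ, IsRepresentedBy.{u} f G := by
  induction k, hjk using Nat.le_induction with
  | base => exact ⟨F, h⟩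
  | succ k _ ih =>
    obtain ⟨G, hG⟩ := ih
    exact ⟨_, hG.succ⟩

theorem isRepresentedBy_base {n : ℕ} (t : Fin n → Fin (T + 1)) (g : (Fin n → U) →ᵇ ℝ) :
    IsRepresentedBy.{u} (base n t g) (k := 0) fun x => g fun i => x (t i) := fun _ =>
  EventuallyEq.rfl

theorem exists_isRepresentedBy (f : AdaptedFunctional T U) {k : ℕ} (hk : f.rank ≤ k) :
    ∃ F : (Fin (T + 1) → rankSpace T U k) →ᵇ ℝ, IsRepresentedBy.{u} f F := by
  induction f generalizing k with
  | base n t g =>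
    let F : (Fin (T + 1) → rankSpace T U 0) →ᵇ ℝ := g.compContinuous
      ⟨fun x i => x (t i), continuous_pi fun i => continuous_apply (t i)⟩
    exact exists_isRepresentedBy_of_le (F := F) (Nat.zero_le k) (isRepresentedBy_base t g)
  | comp n f g ih =>
    choose F hF using fun i => ih i ((Finset.le_sup (Finset.mem_univ i)).trans hk)
    exact ⟨g.compContinuous ⟨fun x i => F i x, continuous_pi fun i => (F i).continuous⟩,
      IsRepresentedBy.comp hF g⟩
  | condExp f t ih =>
    -- A conditional expectation has rank at least one, so `k` is a successor.
    obtain ⟨k, rfl⟩ := Nat.exists_eq_add_of_le' ((Nat.le_add_left 1 _).trans hk)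
    obtain ⟨F, hF⟩ := ih (Nat.le_of_succ_le_succ hk)
    exact ⟨(integralBCF F).compContinuous ⟨fun μ => μ t, continuous_apply t⟩, hF.condExp t⟩

end AdaptedFunctional

theorem extendedWeakTopology_le_adaptedTopology (T : ℕ) (U : Type v) [TopologicalSpace U]
    [PolishSpace U] [MeasurableSpace U] [BorelSpace U] (r : ℕ) :
    extendedWeakTopology.{u, v} T U r ≤ adaptedTopology.{u, v} T U r := by
  refine le_iInf fun ⟨f, hf⟩ => ?_
  obtain ⟨F, hF⟩ := f.exists_isRepresentedBy.{u} hf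
  rw [show adaptedExpectation f = predictionExpectation r F from funext hF.adaptedExpectation_eq]
  exact iInf_le _ F

/-! ### Compact state spaces -/

section Compact

open AdaptedFunctional

variable {T : ℕ} {U : Type v} [TopologicalSpace U] [PolishSpace U] [MeasurableSpace U]
  [BorelSpace U] [CompactSpace U]

instance compactSpace_rankSpace (k : ℕ) : CompactSpace (rankSpace T U k) := by
  induction k with
  | zero => assumption
  | succ k ih =>
    exact inferInstanceAs (CompactSpace (ProbabilityMeasure (Fin (T + 1) → rankSpace T U k)))

/-- Continuous functions of represented functionals are represented: on a compact space the outer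
function can be truncated. -/
theorem exists_isRepresentedBy_comp {k n : ℕ} (h : C(Fin n → ℝ, ℝ))
    (F : Fin n → C(Fin (T + 1) → rankSpace T U k, ℝ))
    (hF : ∀ i, ∃ f : AdaptedFunctional T U, f.rank ≤ k ∧ IsRepresentedBy.{u} f (F i)) :
    ∃ f : AdaptedFunctional T U, f.rank ≤ k ∧
      IsRepresentedBy.{u} f fun x => h fun i => F i x := by
  choose f hfk hf using hF
  let H : C(Fin (T + 1) → rankSpace T U k, ℝ) := h.comp (ContinuousMap.pi F)
  have hH : ∀ x, |h fun i => F i x| ≤ ‖H‖ := fun x => H.norm_coe_le_norm x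
  -- Clamping at the sup norm of the composite `H` makes `h` bounded without changing it on the
  -- values taken by `F`.
  let g : (Fin n → ℝ) →ᵇ ℝ := BoundedContinuousFunction.ofNormedAddCommGroup
    (fun y => max (-‖H‖) (min ‖H‖ (h y))) (by fun_prop) ‖H‖ fun y => by
      rw [Real.norm_eq_abs, abs_le]
      exact ⟨le_max_left _ _, max_le (by linarith [norm_nonneg H]) (min_le_left _ _)⟩
  refine ⟨comp n f g, Finset.sup_le fun i _ => hfk i, ?_⟩
  have hg : (fun x => h fun i => F i x) = fun x => g fun i => F i x := by
    ext x
    obtain ⟨h1, h2⟩ := abs_le.1 (hH x)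
    change _ = max (-‖H‖) (min ‖H‖ (h fun i => F i x))
    rw [min_eq_right h2, max_eq_right h1]
  rw [hg]
  exact IsRepresentedBy.comp hf g

variable (T U) in
/-- The continuous functions on the path space of the rank `k` prediction processes which represent
an adapted functional of rank at most `k`. -/
def representedSubalgebra (k : ℕ) : Subalgebra ℝ C(Fin (T + 1) → rankSpace T U k, ℝ) where
  carrier := {F | ∃ f : AdaptedFunctional T U, f.rank ≤ k ∧ IsRepresentedBy.{u} f F}
  mul_mem' {F G} hF hG := by
    have := exists_isRepresentedBy_comp.{u} ⟨fun y : Fin 2 → ℝ => y 0 * y 1, by fun_prop⟩ ![F, G]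
      (by simpa [Fin.forall_fin_two] using ⟨hF, hG⟩)
    simpa using! this
  add_mem' {F G} hF hG := by
    have := exists_isRepresentedBy_comp.{u} ⟨fun y : Fin 2 → ℝ => y 0 + y 1, by fun_prop⟩ ![F, G]
      (by simpa [Fin.forall_fin_two] using ⟨hF, hG⟩)
    simpa using! this
  algebraMap_mem' c :=
    exists_isRepresentedBy_comp.{u} ⟨fun _ : Fin 0 → ℝ => c, by fun_prop⟩ ![] (fun i => i.elim0)

/-- Integration against a probability measure is continuous in the sup norm, so a dense set of
integrands determines the measure. -/
theorem probabilityMeasure_eq_of_dense {E : Type*} [TopologicalSpace E]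
    [CompactSpace E] [MetrizableSpace E] [MeasurableSpace E] [BorelSpace E]
    {S : Set C(E, ℝ)} (hS : Dense S) {μ ν : ProbabilityMeasure E}
    (h : ∀ F ∈ S, ∫ x, F x ∂(μ : Measure E) = ∫ x, F x ∂(ν : Measure E)) : μ = ν := by
  suffices hF : ∀ F : E →ᵇ ℝ, ∫ x, F x ∂(μ : Measure E) = ∫ x, F x ∂(ν : Measure E) from
    Subtype.ext (ext_of_forall_integral_eq_of_IsFiniteMeasure (μ := μ.toMeasure)
      (ν := ν.toMeasure) hF)
  intro F
  have hc : ∀ ρ : ProbabilityMeasure E,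
      Continuous fun G : C(E, ℝ) => ∫ x, G x ∂(ρ : Measure E) := fun ρ => 
    (continuous_integral.comp (ContinuousMap.toLp 1 (ρ : Measure E) ℝ).continuous).congr fun G =>
      integral_congr_ae (ContinuousMap.coeFn_toLp (ρ : Measure E) G)
  exact congrFun ((hc μ).ext_on hS (hc ν) h) F.toContinuousMap

/-- Stone–Weierstrass: two distinct rank `k + 1` paths differ at some time `t` as laws, and by
density at rank `k` a represented `F` has different integrals against them. The conditional
expectation at `t` of its functional represents `μ ↦ ∫ F dμ_t`, which separates the two paths. -/
theorem representedSubalgebra_dense (k : ℕ) :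
    Dense (representedSubalgebra.{u} T U k : Set C(Fin (T + 1) → rankSpace T U k, ℝ)) := by
  induction k with
  | zero =>
    intro F
    refine subset_closure ?_
    -- At rank `0` every continuous function of the whole path is itself a base functional.
    exact ⟨base (T + 1) id (BoundedContinuousFunction.mkOfCompact F), le_rfl,
      isRepresentedBy_base _ _⟩
  | succ k ih =>
    rw [dense_iff_closure_eq, ← Subalgebra.topologicalClosure_coe,
      ContinuousMap.subalgebra_topologicalClosure_eq_top_of_separatesPoints, Algebra.coe_top]
    intro μ ν hμν
    by_contra! hF
    refine hμν (funext fun t => ?_)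
    refine probabilityMeasure_eq_of_dense ih fun F ⟨f, hfk, hf⟩ => ?_
    by_contra hne
    let G : C(Fin (T + 1) → rankSpace T U (k + 1), ℝ) :=
      ((integralBCF (BoundedContinuousFunction.mkOfCompact F)).toContinuousMap).comp
        ⟨fun μ => μ t, continuous_apply t⟩
    exact hne (hF G ⟨G, ⟨f.condExp t, Nat.succ_le_succ hfk,
      IsRepresentedBy.condExp (F := BoundedContinuousFunction.mkOfCompact F) hf t⟩, rfl⟩)

theorem continuous_predictionExpectation (k : ℕ) (F : (Fin (T + 1) → rankSpace T U k) →ᵇ ℝ) :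
    Continuous[adaptedTopology.{u, v} T U k, inferInstance] (predictionExpectation k F) := by
  let := adaptedTopology.{u, v} T U k
  -- The approximation is uniform in the process because the sup norm bound on `F - G` does not
  -- involve the law of the path.
  refine continuous_of_uniform_approx_of_continuous fun s hs => ?_
  obtain ⟨ε, hε, hs⟩ := Metric.mem_uniformity_dist.1 hs
  obtain ⟨G, ⟨f, hfk, hf⟩, hG⟩ :=
    (representedSubalgebra_dense.{u} k).exists_dist_lt F.toContinuousMap hε
  refine ⟨adaptedExpectation f, ?_, fun A => hs ?_⟩
  · exact continuous_iInf_dom (i := ⟨f, hfk⟩) continuous_induced_dom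
  · have hd : ∀ x, ‖F x - G x‖ ≤ dist F.toContinuousMap G := fun x => by
      rw [← dist_eq_norm]
      exact ContinuousMap.dist_apply_le_dist x
    rw [Real.dist_eq, A.predictionExpectation_eq, adaptedExpectation, integral_congr_ae (hf A),
      ← integral_sub]
    · refine (norm_integral_le_of_norm_le_const (Eventually.of_forall fun ω => hd _)).trans_lt ?_
      simpa using hG
    · exact Integrable.of_bound
        (F.continuous.measurable.comp (A.measurable_rankPath k)).aestronglyMeasurable ‖F‖
        (Eventually.of_forall fun ω => F.norm_coe_le_norm _)
    · exact Integrable.of_bound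
        (G.continuous.measurable.comp (A.measurable_rankPath k)).aestronglyMeasurable ‖G‖
        (Eventually.of_forall fun ω => G.norm_coe_le_norm _)

theorem adaptedTopology_eq_extendedWeakTopology (r : ℕ) :
    adaptedTopology.{u, v} T U r = extendedWeakTopology.{u, v} T U r :=
  le_antisymm (le_iInf fun F => (continuous_predictionExpectation r F).le_induced)
    (extendedWeakTopology_le_adaptedTopology T U r)

end Compact

end

/-- Let `V` be a separable Banach space. The extended weak topology of rank `r` on the adapted
processes with values in `V` is finer than the adapted topology of rank `r`; in particular,
convergence of sequences in the former implies convergence in the latter. For processes with values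
in a compact subset `K` of `V` the two topologies coincide and have the same convergent sequences.
In Mathlib's order on topologies `s ≤ t` means that `s` is finer than `t`. -/
theorem proposition4p7 {V : Type v} [NormedAddCommGroup V] [NormedSpace ℝ V]
    [CompleteSpace V] [TopologicalSpace.SeparableSpace V] [MeasurableSpace V] [BorelSpace V]
    (T r : ℕ) :
    (extendedWeakTopology.{u, v} T V r ≤ adaptedTopology.{u, v} T V r ∧
      ∀ (A : ℕ → AdaptedProcess.{u, v} T V) (B : AdaptedProcess.{u, v} T V),
        ConvergesExtendedWeak r A B → ConvergesAdapted r A B) ∧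
    ∀ (K : Set V) [CompactSpace K],
      adaptedTopology.{u, v} T K r = extendedWeakTopology.{u, v} T K r ∧
      ∀ (A : ℕ → AdaptedProcess.{u, v} T K) (B : AdaptedProcess.{u, v} T K),
        ConvergesAdapted r A B ↔ ConvergesExtendedWeak r A B := by
  refine ⟨⟨extendedWeakTopology_le_adaptedTopology T V r, fun A B h => ?_⟩, fun K _ => ?_⟩
  · rw [← tendsto_adaptedTopology_iff]
    exact (tendsto_extendedWeakTopology_iff.2 h).mono_right
      (nhds_mono (extendedWeakTopology_le_adaptedTopology T V r))
  · have h := adaptedTopology_eq_extendedWeakTopology.{u} (T := T) (U := K) r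
    refine ⟨h, fun A B => ?_⟩
    rw [← tendsto_adaptedTopology_iff, ← tendsto_extendedWeakTopology_iff, h]
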